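/- **Theorem 1.3.** Let $(X,d)$ be a proper geodesic metric space and let $\mu$ be a Borel measure on $X$ with $0<\mu(B(x,r))<\infty$ for every open ball. Let $K,n\in\mathbb R$ with either $n>1$, or $n=1$ and $K\le 0$. Put $$s_K(\theta)=\frac{\sin(\sqrt K\,\theta)}{\sqrt K}\ (K>0),\qquad s_0(\theta)=\theta,\qquad s_K(\theta)=\frac{\sinh(\sqrt{-K}\,\theta)}{\sqrt{-K}}\ (K<0).$$ Let $\Gamma(X)$ be the space of minimal geodesics $\gamma:[0,1]\to X$ parametrized proportionally to arc length, with the topology of uniform convergence; write $\ell(\gamma)=d(\gamma(0),\gamma(1))$ and $e_t(\gamma)=\gamma(t)$. Assume that $(X,d,\mu)$ is an $MCP(K,n)$ space in the sense of Ohta: for every $x\in X$ and every Borel set $A\subset X$ with $0<\mu(A)<\infty$ (and, if $K>0$, $A\subset B(x,\pi\sqrt{(n-1)/K})$) there is a Borel probability measure $\Pi$ on $\Gamma(X)$ such that $(e_0)_*\Pi=\delta_x$, $(e_1)_*\Pi=\mu|_A/\mu(A)$ and, for every $t\in[0,1]$, $$(e_t)_*\left[\,t\left(\frac{s_K\big(t\,\ell(\gamma)/\sqrt{n-1}\big)}{s_K\big(\ell(\gamma)/\sqrt{n-1}\big)}\right)^{n-1}\mu(A)\,d\Pi(\gamma)\right]\le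 \mu ,$$ where $0/0=1$ (the case $\ell(\gamma)=0$) and the power is read as $1$ if $n=1$. Let $p>n+1$. Then $(X,d,\mu)$ satisfies a local $(1,p)$-Poincaré inequality: there are $r_0>0$ and $C,C'>0$ such that for all $0<r<r_0$, all $x\in X$, all integers $m\ge 0$ and all Lipschitz functions $f:X\to\mathbb R^m$, $$\frac1{\mu(B(x,r))}\int_{B(x,r)}|f-f_{B(x,r)}|\,d\mu\le C'r\left(\frac1{\mu(B(x,Cr))}\int_{B(x,Cr)}(\operatorname{lip} f)^p\,d\mu\right)^{1/p},$$ where $f_{B}=\frac1{\mu(B)}\int_B f\,d\mu$ and $\operatorname{lip}f(y)=\liminf_{s\to0^+}\sup_{z\in B(y,s)}\frac{|f(z)-f(y)|}{s}$. If moreover $K\ge 0$, then $(X,d,\mu)$ satisfies a global $(1,p)$-Poincaré inequality: there are $C,C'>0$ such that the inequality holds for all $r>0$ and all such $x,m,f$. -/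

import Mathlib

open MeasureTheory Set Filter Topology
open scoped ENNReal NNReal

noncomputable section

namespace MCPPoincare

/-- The space `Γ(X)` of minimal geodesics of `X`, parametrized proportionally to arc length
by `[0,1]`. -/
def Geo (X : Type*) [MetricSpace X] : Type _ :=
  {γ : C(unitInterval, X) // ∀ s t : unitInterval,
    dist (γ s) (γ t) = |(s : ℝ) - (t : ℝ)| * dist (γ 0) (γ 1)}

namespace Geo

variable {X : Type*} [MetricSpace X]

/-- The topology of uniform convergence. -/
instance : TopologicalSpace (Geo X) := instTopologicalSpaceSubtype

instance : MeasurableSpace (Geo X) := borel (Geo X)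

instance : BorelSpace (Geo X) := ⟨rfl⟩

/-- The evaluation map `e_t`. -/
def ev (t : unitInterval) (γ : Geo X) : X := γ.1 t

/-- The length of a minimal geodesic is the distance of its end points. -/
def length (γ : Geo X) : ℝ := dist (ev 0 γ) (ev 1 γ)

theorem continuous_ev (t : unitInterval) : Continuous (ev (X := X) t) :=
  (continuous_eval_const t).comp continuous_subtype_val

theorem measurable_ev [MeasurableSpace X] [BorelSpace X] (t : unitInterval) :
    Measurable (ev (X := X) t) :=
  (continuous_ev t).measurable

end Geo

/-- The generalized sine function `s_K` of the comparison space of curvature `K`. -/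
def sK (K θ : ℝ) : ℝ :=
  if 0 < K then Real.sin (√K * θ) / √K
  else if K = 0 then θ
  else Real.sinh (√(-K) * θ) / √(-K)

/-- The distortion coefficient
`t * (s_K (t ℓ / √(n-1)) / s_K (ℓ / √(n-1))) ^ (n-1)`,
with the conventions that `0/0 = 1` (the case `ℓ = 0`) and that the power is `1` if `n = 1`. -/
def mcpCoeff (K n t ℓ : ℝ) : ℝ :=
  if n = 1 ∨ ℓ = 0 then t
  else t * (sK K (t * ℓ / √(n - 1)) / sK K (ℓ / √(n - 1))) ^ (n - 1)

/-- The measure contraction property `MCP(K,n)` of Ohta for a geodesic metric space with a Borel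
measure for which all balls have positive and finite measure. The parameters are `n > 1`, or
`n = 1` and `K ≤ 0`. -/
structure IsMCP {X : Type*} [MetricSpace X] [MeasurableSpace X] [BorelSpace X]
    (K n : ℝ) (μ : Measure X) : Prop where
  one_le : 1 ≤ n
  nonpos_of_eq_one : n = 1 → K ≤ 0
  geodesic : ∀ x y : X, ∃ γ : Geo X, Geo.ev 0 γ = x ∧ Geo.ev 1 γ = y
  ball_pos : ∀ (x : X) (r : ℝ), 0 < r → 0 < μ (Metric.ball x r)
  ball_lt_top : ∀ (x : X) (r : ℝ), μ (Metric.ball x r) < ∞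
  contraction : ∀ (x : X) (A : Set X), MeasurableSet A → 0 < μ A → μ A < ∞ →
    (0 < K → A ⊆ Metric.ball x (Real.pi * √((n - 1) / K))) →
    ∃ P : Measure (Geo X), IsProbabilityMeasure P ∧
      P.map (Geo.ev 0) = Measure.dirac x ∧
      P.map (Geo.ev 1) = (μ A)⁻¹ • μ.restrict A ∧
      ∀ t : unitInterval,
        (P.withDensity fun γ => ENNReal.ofReal (mcpCoeff K n t γ.length) * μ A).map (Geo.ev t) ≤ μ

/-- The lower pointwise Lipschitz constant
`lip f (x) = liminf_{r → 0+} sup_{y ∈ B(x,r)} |f(y) - f(x)| / r`. -/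
def lowerLip {X E : Type*} [MetricSpace X] [MetricSpace E] (f : X → E) (x : X) : ℝ≥0∞ :=
  liminf (fun r : ℝ => ⨆ y ∈ Metric.ball x r, edist (f y) (f x) / ENNReal.ofReal r) (𝓝[>] 0)

/-- The `(1,p)`-Poincaré inequality with constants `(C, C')` on all balls of radius `r`, for all
Lipschitz functions with values in a Euclidean space. -/
def PoincareAtScale {X : Type*} [MetricSpace X] [MeasurableSpace X]
    (μ : Measure X) (p C C' r : ℝ) : Prop :=
  ∀ (m : ℕ) (f : X → EuclideanSpace ℝ (Fin m)), (∃ L : ℝ≥0, LipschitzWith L f) → ∀ x : X,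
    ⨍⁻ y in Metric.ball x r, ‖f y - ⨍ z in Metric.ball x r, f z ∂μ‖ₑ ∂μ ≤
      ENNReal.ofReal (C' * r) *
        (⨍⁻ y in Metric.ball x (C * r), lowerLip f y ^ p ∂μ) ^ (1 / p)

/-- The local `(1,p)`-Poincaré inequality: the inequality holds, with fixed constants, on all balls
of radius less than some `r₀ > 0`. -/
def LocalPoincare {X : Type*} [MetricSpace X] [MeasurableSpace X] (μ : Measure X) (p : ℝ) : Prop :=
  ∃ r₀ : ℝ, 0 < r₀ ∧ ∃ C C' : ℝ, 0 < C ∧ 0 < C' ∧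
    ∀ r : ℝ, 0 < r → r < r₀ → PoincareAtScale μ p C C' r

/-- The global `(1,p)`-Poincaré inequality: the inequality holds, with fixed constants, on all
balls. -/
def GlobalPoincare {X : Type*} [MetricSpace X] [MeasurableSpace X] (μ : Measure X) (p : ℝ) : Prop :=
  ∃ C C' : ℝ, 0 < C ∧ 0 < C' ∧ ∀ r : ℝ, 0 < r → PoincareAtScale μ p C C' r

end MCPPoincare

end

/-!
The inequality holds on every ball `B = B(x,r)` with the same ball on the right hand side, and
already for `p > n`, by transporting mass from the centre only.

Apply the contraction property to the centre `x` and `A = B`, which gives a probability measure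
`P` on geodesics issuing from `x`. Since `lip f` is an upper gradient along geodesics
(`edist_le_lintegral_lowerLip`), the mean of `|f - f x|` on `B` is at most
`r * ∫₀¹ ∫ lip f (γ t) dP(γ) dt`. Geodesics from the centre stay in `B`, and the distortion
coefficients are at least `c * t ^ n`, so by Jensen's inequality the inner integral is at most
`(c * t ^ n) ^ (-1/p)` times the `L^p` mean of `lip f` on `B`. The factor `t ^ (-n/p)` is integrable
(`IsMCP.laverage_edist_center_le`), and replacing `f x` by the mean of `f` costs a factor two.

For `K = 0` the coefficients are `t ^ n` (at positive distance); they are at least `t ^ n` for `K > 0` below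
the critical radius `R = π √((n-1)/K)` by concavity of the sine, and are comparable to `t ^ n` at
small scales for `K < 0`. For `K > 0` and `r > R` one uses that `B(x,r)` agrees with `B(x,R)` up to
a null set: the diameter is at most `R` (`IsMCP.dist_le_bonnetMyersRadius`) and the spheres of
radius `R` are null because they are porous (`IsMCP.measure_sphere`).
-/

namespace MCPPoincare

/-! ### Bounds for the distortion coefficients -/

theorem rpow_eq_mul_rpow_sub_one {t n : ℝ} (ht : 0 ≤ t) (hn : 1 ≤ n) :
    t ^ n = t * t ^ (n - 1) := by
  rcases ht.eq_or_lt with rfl | ht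
  · simp [Real.zero_rpow (by linarith : n ≠ 0)]
  · rw [← Real.rpow_one_add' ht.le (by linarith)]; congr 1; ring

theorem rpow_le_mcpCoeff_zero {n t ℓ : ℝ} (hn : 1 ≤ n) (ht : 0 ≤ t) (ht1 : t ≤ 1) :
    t ^ n ≤ mcpCoeff 0 n t ℓ := by
  unfold mcpCoeff
  split_ifs with h
  · simpa using Real.rpow_le_rpow_of_exponent_ge' ht ht1 zero_le_one hn
  · push Not at h
    have hn1 : 0 < n - 1 := by
      rcases hn.lt_or_eq with h' | h'
      · linarith
      · exact absurd h'.symm h.1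
    have hs : 0 < √(n - 1) := Real.sqrt_pos.2 hn1
    have : sK 0 (t * ℓ / √(n - 1)) / sK 0 (ℓ / √(n - 1)) = t := by
      simp only [sK, lt_irrefl, if_false, if_true]
      have := h.2
      field_simp
    rw [this, rpow_eq_mul_rpow_sub_one ht hn]

theorem mul_sin_le_sin_mul {t θ : ℝ} (ht : 0 ≤ t) (ht1 : t ≤ 1) (hθ : 0 ≤ θ) (hθπ : θ ≤ Real.pi) :
    t * Real.sin θ ≤ Real.sin (t * θ) := by
  have := strictConcaveOn_sin_Icc.concaveOn.2 (x := θ) (y := 0) ⟨hθ, hθπ⟩ ⟨le_rfl, Real.pi_pos.le⟩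
    ht (sub_nonneg.2 ht1) (by ring)
  simpa using this

/-- The distance at which the coefficients of `MCP(K,n)` with `0 < K` degenerate. -/
noncomputable def bonnetMyersRadius (K n : ℝ) : ℝ := Real.pi * √((n - 1) / K)

theorem bonnetMyersRadius_pos {K n : ℝ} (hK : 0 < K) (hn : 1 < n) : 0 < bonnetMyersRadius K n :=
  mul_pos Real.pi_pos (Real.sqrt_pos.2 (div_pos (by linarith) hK))

theorem mcpCoeff_eq_sin {K n : ℝ} (hK : 0 < K) (hn : 1 < n) (t : ℝ) {ℓ : ℝ} (hℓ : ℓ ≠ 0) :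
    mcpCoeff K n t ℓ = t * (Real.sin (t * (Real.pi * ℓ / bonnetMyersRadius K n)) /
      Real.sin (Real.pi * ℓ / bonnetMyersRadius K n)) ^ (n - 1) := by
  have h1 : 0 < √K := Real.sqrt_pos.2 hK
  have h2 : 0 < √(n - 1) := Real.sqrt_pos.2 (by linarith)
  have e : Real.pi * ℓ / bonnetMyersRadius K n = √K * (ℓ / √(n - 1)) := by
    rw [bonnetMyersRadius, Real.sqrt_div (by linarith)]
    have := Real.pi_pos
    field_simp
  have e' : t * (Real.pi * ℓ / bonnetMyersRadius K n) = √K * (t * ℓ / √(n - 1)) := by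
    rw [e]; ring
  rw [mcpCoeff, if_neg (by push Not; exact ⟨hn.ne', hℓ⟩), e', e]
  simp only [sK, hK, if_true]
  rw [div_div_div_cancel_right₀ h1.ne']

theorem rpow_le_mcpCoeff_of_pos {K n t ℓ : ℝ} (hK : 0 < K) (hn : 1 < n) (ht : 0 ≤ t) (ht1 : t ≤ 1)
    (hℓ : 0 ≤ ℓ) (hℓR : ℓ < bonnetMyersRadius K n) : t ^ n ≤ mcpCoeff K n t ℓ := by
  rcases hℓ.eq_or_lt with rfl | hℓ
  · simpa [mcpCoeff] using Real.rpow_le_rpow_of_exponent_ge' ht ht1 zero_le_one hn.le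
  rw [mcpCoeff_eq_sin hK hn t hℓ.ne', rpow_eq_mul_rpow_sub_one ht hn.le]
  have hR := bonnetMyersRadius_pos hK hn
  have h0 : 0 < Real.pi * ℓ / bonnetMyersRadius K n := by have := Real.pi_pos; positivity
  have h1 : Real.pi * ℓ / bonnetMyersRadius K n < Real.pi := by
    rw [div_lt_iff₀ hR]; exact mul_lt_mul_of_pos_left hℓR Real.pi_pos
  refine mul_le_mul_of_nonneg_left (Real.rpow_le_rpow ht ?_ (by linarith)) ht
  rw [le_div_iff₀ (Real.sin_pos_of_pos_of_lt_pi h0 h1)]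
  exact mul_sin_le_sin_mul ht ht1 h0.le h1.le

/-- Close to the critical distance the coefficient for `t = 1/2` blows up, because
`sin (θ/2) / sin θ = 1 / (2 cos (θ/2))` and `cos (θ/2) ≤ (π - θ)/2`. -/
theorem le_mcpCoeff_half {K n ℓ ε : ℝ} (hK : 0 < K) (hn : 1 < n) (hε : 0 < ε) (hℓ : 0 < ℓ)
    (hℓR : ℓ < bonnetMyersRadius K n) (hℓε : bonnetMyersRadius K n - ε ≤ ℓ) :
    1 / 2 * (bonnetMyersRadius K n / (Real.pi * ε)) ^ (n - 1) ≤ mcpCoeff K n (1 / 2) ℓ := by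
  rw [mcpCoeff_eq_sin hK hn _ hℓ.ne']
  have hR := bonnetMyersRadius_pos hK hn
  set R := bonnetMyersRadius K n
  set θ := Real.pi * ℓ / R with hθ
  have hpi := Real.pi_pos
  have h0 : 0 < θ := by positivity
  have h1 : θ < Real.pi := by
    rw [hθ, div_lt_iff₀ hR]; exact mul_lt_mul_of_pos_left hℓR Real.pi_pos
  have hc : 0 < Real.cos (θ / 2) :=
    Real.cos_pos_of_mem_Ioo ⟨by linarith, by linarith⟩
  have hs : 0 < Real.sin (θ / 2) := Real.sin_pos_of_pos_of_lt_pi (by linarith) (by linarith)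
  have hcle : Real.cos (θ / 2) ≤ (Real.pi - θ) / 2 := by
    rw [← Real.sin_pi_div_two_sub]
    refine (Real.sin_le (by linarith)).trans (by linarith)
  have hθε : Real.pi - θ ≤ Real.pi * ε / R := by
    rw [hθ, sub_le_iff_le_add, ← add_div, le_div_iff₀ hR, ← mul_add]
    exact mul_le_mul_of_nonneg_left (by linarith) hpi.le
  have e : Real.sin (1 / 2 * θ) / Real.sin θ = 1 / (2 * Real.cos (θ / 2)) := by
    have : Real.sin θ = 2 * Real.sin (θ / 2) * Real.cos (θ / 2) := by
      rw [← Real.sin_two_mul]; congr 1; ring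
    rw [this, show 1 / 2 * θ = θ / 2 by ring]
    field_simp
  rw [e]
  refine mul_le_mul_of_nonneg_left (Real.rpow_le_rpow (by positivity) ?_ (by linarith)) (by norm_num)
  rw [show R / (Real.pi * ε) = 1 / (Real.pi * ε / R) by field_simp]
  exact one_div_le_one_div_of_le (by positivity) (by linarith)

/-- For negative curvature the coefficient is comparable to `t ^ n` at small distances. -/
theorem exists_le_mcpCoeff_of_neg {K n : ℝ} (hK : K < 0) (hn : 1 ≤ n) :
    ∃ r₀ : ℝ, 0 < r₀ ∧ ∃ c : ℝ, 0 < c ∧ ∀ t ℓ : ℝ, 0 ≤ t → t ≤ 1 → 0 ≤ ℓ → ℓ < r₀ →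
      c * t ^ n ≤ mcpCoeff K n t ℓ := by
  rcases hn.eq_or_lt with rfl | hn'
  · exact ⟨1, one_pos, 1, one_pos, fun t ℓ _ _ _ _ => by simp [mcpCoeff]⟩
  have h1 : 0 < √(-K) := Real.sqrt_pos.2 (by linarith)
  have h2 : 0 < √(n - 1) := Real.sqrt_pos.2 (by linarith)
  refine ⟨√(n - 1) / √(-K), by positivity, (1 / 2) ^ (n - 1), by positivity, ?_⟩
  intro t ℓ ht ht1 hℓ hℓr
  have hhalf : ((1 : ℝ) / 2) ^ (n - 1) ≤ 1 :=
    Real.rpow_le_one (by norm_num) (by norm_num) (by linarith)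
  rcases hℓ.eq_or_lt with rfl | hℓ
  · have := Real.rpow_le_rpow_of_exponent_ge' ht ht1 zero_le_one hn
    rw [Real.rpow_one] at this
    simp only [mcpCoeff, or_true, if_true]
    nlinarith [Real.rpow_nonneg ht n]
  rw [mcpCoeff, if_neg (by push Not; exact ⟨hn'.ne', hℓ.ne'⟩), rpow_eq_mul_rpow_sub_one ht hn]
  simp only [sK, not_lt.2 hK.le, hK.ne, if_false]
  rw [div_div_div_cancel_right₀ h1.ne', show √(-K) * (t * ℓ / √(n - 1)) =
    t * (√(-K) * (ℓ / √(n - 1))) by ring]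
  set θ := √(-K) * (ℓ / √(n - 1)) with hθ
  have h0 : 0 < θ := by positivity
  have hθ1 : θ ≤ 1 := by
    rw [lt_div_iff₀ h1] at hℓr
    rw [hθ, ← mul_div_assoc, div_le_one h2]; linarith
  have hsinh : Real.sinh θ ≤ 2 * θ := by
    have a1 := abs_le.1 (Real.abs_exp_sub_one_sub_id_le (x := θ) (by rw [abs_of_pos h0]; exact hθ1))
    have a2 := abs_le.1 (Real.abs_exp_sub_one_sub_id_le (x := -θ)
      (by rw [abs_neg, abs_of_pos h0]; exact hθ1))
    rw [Real.sinh_eq]; nlinarith [a1.2, a2.1]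
  have hle : t * θ ≤ Real.sinh (t * θ) := Real.self_le_sinh_iff.2 (by positivity)
  have hq : 1 / 2 * t ≤ Real.sinh (t * θ) / Real.sinh θ := by
    rw [le_div_iff₀ (Real.sinh_pos_iff.2 h0)]
    nlinarith
  calc (1 / 2) ^ (n - 1) * (t * t ^ (n - 1)) = t * (1 / 2 * t) ^ (n - 1) := by
        rw [Real.mul_rpow (by norm_num) ht]; ring
    _ ≤ _ := mul_le_mul_of_nonneg_left
        (Real.rpow_le_rpow (by positivity) hq (by linarith)) ht

/-! ### Contraction along geodesics -/

section Contraction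

variable {X : Type*} [MetricSpace X]

namespace Geo

theorem dist_ev_ev (γ : Geo X) (s t : unitInterval) :
    dist (ev s γ) (ev t γ) = |(s : ℝ) - t| * γ.length := γ.2 s t

theorem length_nonneg (γ : Geo X) : 0 ≤ γ.length := dist_nonneg

theorem dist_ev_zero_ev (γ : Geo X) (t : unitInterval) : dist (ev 0 γ) (ev t γ) = t * γ.length := by
  rw [dist_ev_ev]; simp [abs_of_nonneg t.2.1]

theorem dist_ev_ev_one (γ : Geo X) (t : unitInterval) :
    dist (ev t γ) (ev 1 γ) = (1 - t) * γ.length := by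
  rw [dist_ev_ev, abs_sub_comm]; simp [abs_of_nonneg (sub_nonneg.2 t.2.2)]

end Geo

/-- A point at prescribed distance from the origin of a minimal geodesic. -/
theorem IsMCP.exists_between [MeasurableSpace X] [BorelSpace X] {K n : ℝ} {μ : Measure X}
    (hX : IsMCP K n μ) (x y : X) {a : ℝ} (ha : 0 ≤ a) (hay : a ≤ dist x y) :
    ∃ z, dist x z = a ∧ dist z y = dist x y - a := by
  rcases ha.eq_or_lt with rfl | ha
  · exact ⟨x, by simp, by simp⟩
  have hpos : 0 < dist x y := ha.trans_le hay
  obtain ⟨γ, rfl, rfl⟩ := hX.geodesic x y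
  let t : unitInterval :=
    ⟨a / γ.length, div_nonneg ha.le hpos.le, (div_le_one hpos).2 hay⟩
  have e : (t : ℝ) * γ.length = a := div_mul_cancel₀ _ hpos.ne'
  refine ⟨Geo.ev t γ, by rw [Geo.dist_ev_zero_ev, e], ?_⟩
  rw [Geo.dist_ev_ev_one, sub_mul, one_mul, e]; rfl

variable [ProperSpace X] [MeasurableSpace X] [BorelSpace X] {K n : ℝ} {μ : Measure X}

instance : SecondCountableTopology (Geo X) := TopologicalSpace.Subtype.secondCountableTopology _

/-- The contraction property in integrated form: along geodesics from `x` to `A` the distribution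
of the time `t` points is controlled by `μ`, as soon as the distortion coefficients have the lower
bound `c` and the time `t` points lie in `T`. -/
theorem IsMCP.exists_contraction (hX : IsMCP K n μ) (x : X) {A : Set X} (hA : MeasurableSet A)
    (hA0 : 0 < μ A) (hAtop : μ A < ∞) (hAK : 0 < K → A ⊆ Metric.ball x (bonnetMyersRadius K n)) :
    ∃ P : Measure (Geo X), IsProbabilityMeasure P ∧
      (∀ᵐ γ ∂P, Geo.ev 0 γ = x ∧ Geo.ev 1 γ ∈ A) ∧
      P.map (Geo.ev 1) = (μ A)⁻¹ • μ.restrict A ∧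
      ∀ (t : unitInterval) (c : ℝ) (T : Set X) (g : X → ℝ≥0∞), MeasurableSet T → Measurable g →
        (∀ γ : Geo X, Geo.ev 0 γ = x → Geo.ev 1 γ ∈ A →
          Geo.ev t γ ∈ T ∧ c ≤ mcpCoeff K n t γ.length) →
        ENNReal.ofReal c * μ A * ∫⁻ γ, g (Geo.ev t γ) ∂P ≤ ∫⁻ y in T, g y ∂μ := by
  obtain ⟨P, hP, h0, h1, ht⟩ := hX.contraction x A hA hA0 hAtop hAK
  have hae : ∀ᵐ γ ∂P, Geo.ev 0 γ = x ∧ Geo.ev 1 γ ∈ A := by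
    have a0 : ∀ᵐ y ∂(P.map (Geo.ev 0)), y = x := by
      rw [h0, ae_dirac_eq]
      exact eventually_pure.2 rfl
    have a1 : ∀ᵐ y ∂(P.map (Geo.ev 1)), y ∈ A := by
      rw [h1]
      exact Measure.ae_smul_measure (ae_restrict_mem hA) _
    exact (ae_of_ae_map (Geo.measurable_ev 0).aemeasurable a0).and
      (ae_of_ae_map (Geo.measurable_ev 1).aemeasurable a1)
  refine ⟨P, hP, hae, h1, fun t c T g hT hg hc => ?_⟩
  have hle : ((ENNReal.ofReal c * μ A) • P).map (Geo.ev t) ≤ μ := by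
    refine le_trans (Measure.map_mono ?_ (Geo.measurable_ev t)) (ht t)
    rw [← withDensity_const]
    refine withDensity_mono ?_
    filter_upwards [hae] with γ hγ
    gcongr
    exact (hc γ hγ.1 hγ.2).2
  calc ENNReal.ofReal c * μ A * ∫⁻ γ, g (Geo.ev t γ) ∂P
      = ∫⁻ γ, (T.indicator g) (Geo.ev t γ) ∂((ENNReal.ofReal c * μ A) • P) := by
        rw [lintegral_smul_measure, smul_eq_mul]
        congr 1
        refine lintegral_congr_ae ?_
        filter_upwards [hae] with γ hγ
        rw [indicator_of_mem (hc γ hγ.1 hγ.2).1]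
    _ = ∫⁻ y, T.indicator g y ∂(((ENNReal.ofReal c * μ A) • P).map (Geo.ev t)) :=
        (lintegral_map (hg.indicator hT) (Geo.measurable_ev t)).symm
    _ ≤ ∫⁻ y, T.indicator g y ∂μ := lintegral_mono' hle le_rfl
    _ = ∫⁻ y in T, g y ∂μ := lintegral_indicator hT _

theorem IsMCP.mul_measure_le (hX : IsMCP K n μ) (x : X) {A T : Set X} (hA : MeasurableSet A)
    (hAtop : μ A < ∞) (hAK : 0 < K → A ⊆ Metric.ball x (bonnetMyersRadius K n))
    (hT : MeasurableSet T) (t : unitInterval) (c : ℝ)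
    (h : ∀ γ : Geo X, Geo.ev 0 γ = x → Geo.ev 1 γ ∈ A →
      Geo.ev t γ ∈ T ∧ c ≤ mcpCoeff K n t γ.length) :
    ENNReal.ofReal c * μ A ≤ μ T := by
  rcases eq_zero_or_pos (μ A) with h0 | h0
  · simp [h0]
  obtain ⟨P, hP, -, -, H⟩ := hX.exists_contraction x hA h0 hAtop hAK
  simpa using H t c T (fun _ => 1) hT measurable_const h

end Contraction

/-! ### The lower pointwise Lipschitz constant -/

section LowerLip

variable {X E : Type*} [MetricSpace X] [MetricSpace E]

/-- The lower pointwise Lipschitz constant of a continuous function is a measurable function: the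
oscillation over the open ball of radius `s` is lower semicontinuous in the centre and monotone in
`s`, so that the lower limit can be taken along rational radii. -/
theorem measurable_lowerLip [MeasurableSpace X] [BorelSpace X] {f : X → E} (hf : Continuous f) :
    Measurable (lowerLip f) := by
  let G : ℝ → X → ℝ≥0∞ := fun s x => ⨆ y ∈ Metric.ball x s, edist (f y) (f x) / ENNReal.ofReal s
  have hG : ∀ s, Measurable (G s) := by
    intro s
    refine LowerSemicontinuous.measurable ?_
    rw [lowerSemicontinuous_iff_isOpen_preimage]
    intro a
    have : G s ⁻¹' Ioi a = ⋃ y, (Metric.ball y s ∩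
        (fun x => edist (f y) (f x) / ENNReal.ofReal s) ⁻¹' Ioi a) := by
      ext x
      simp only [G, mem_preimage, mem_Ioi, lt_iSup_iff, mem_iUnion, mem_inter_iff, Metric.mem_ball,
        exists_prop, dist_comm x]
    rw [this]
    refine isOpen_iUnion fun y => ?_
    rcases le_or_gt s 0 with hs | hs
    · simp [Metric.ball_eq_empty.2 hs]
    refine Metric.isOpen_ball.inter (isOpen_Ioi.preimage ?_)
    refine (ENNReal.continuous_div_const _ ?_).comp (continuous_const.edist hf)
    exact (ENNReal.ofReal_pos.2 hs).ne'
  have key : ∀ x, lowerLip f x =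
      ⨆ k : ℕ, ⨅ q : {q : ℚ // (0 : ℝ) < q ∧ (q : ℝ) < 1 / (k + 1)}, G q.1 x := by
    intro x
    have hb : (𝓝[>] (0 : ℝ)).HasBasis (fun _ : ℕ => True) fun k => Ioo (0 : ℝ) (1 / (k + 1)) := by
      refine (nhdsGT_basis (0 : ℝ)).to_hasBasis (fun a ha => ?_) fun k _ =>
        ⟨1 / (k + 1), by positivity, subset_rfl⟩
      obtain ⟨k, hk⟩ := exists_nat_one_div_lt ha
      exact ⟨k, trivial, Ioo_subset_Ioo_right hk.le⟩
    rw [lowerLip, hb.liminf_eq_iSup_iInf]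
    simp only [iSup_true]
    refine iSup_congr fun k => le_antisymm ?_ ?_
    · exact le_iInf fun q => iInf₂_le (q.1 : ℝ) ⟨q.2.1, q.2.2⟩
    · refine le_iInf₂ fun s hs => ?_
      -- Rational radii `q` increasing to `s` lose only the factor `s / q`, which tends to one.
      have hbound : ∀ a : ℝ≥0, 1 < a →
          (⨅ q : {q : ℚ // (0 : ℝ) < q ∧ (q : ℝ) < 1 / (k + 1)}, G q.1 x) ≤ a * G s x := by
        intro a ha
        have ha' : (1 : ℝ) < a := by exact_mod_cast ha
        obtain ⟨q, hq1, hq2⟩ := exists_rat_btwn (div_lt_self hs.1 ha')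
        have hq0 : (0 : ℝ) < q := (div_pos hs.1 (by linarith)).trans hq1
        refine (iInf_le _ ⟨q, hq0, hq2.trans hs.2⟩).trans ?_
        refine iSup₂_le fun y hy => ?_
        have h2 : edist (f y) (f x) / ENNReal.ofReal s ≤ G s x :=
          le_iSup₂_of_le y (Metric.ball_subset_ball hq2.le hy) le_rfl
        refine le_trans ?_ (mul_le_mul_right h2 _)
        rw [ENNReal.div_eq_inv_mul, ENNReal.div_eq_inv_mul, ← mul_assoc]
        gcongr
        rw [← ENNReal.ofReal_coe_nnreal, ← ENNReal.ofReal_inv_of_pos hq0,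
          ← ENNReal.ofReal_inv_of_pos hs.1, ← ENNReal.ofReal_mul (by positivity)]
        apply ENNReal.ofReal_le_ofReal
        rw [div_lt_iff₀ (by linarith)] at hq1
        rw [← div_eq_mul_inv, inv_eq_one_div, div_le_div_iff₀ hq0 hs.1]
        linarith
      have hlim : Tendsto (fun a : ℝ≥0 => (a : ℝ≥0∞) * G s x) (𝓝[>] 1) (𝓝 (1 * G s x)) := by
        refine ENNReal.Tendsto.mul_const ?_ (Or.inl one_ne_zero)
        exact (ENNReal.continuous_coe.tendsto 1).mono_left nhdsWithin_le_nhds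
      rw [one_mul] at hlim
      exact ge_of_tendsto hlim (eventually_nhdsWithin_of_forall fun a ha => hbound a ha)
  have : lowerLip f =
      fun x => ⨆ k : ℕ, ⨅ q : {q : ℚ // (0 : ℝ) < q ∧ (q : ℝ) < 1 / (k + 1)}, G q.1 x := funext key
  rw [this]
  exact Measurable.iSup fun k => Measurable.iInf fun q => hG _

theorem lowerLip_dist_le (f : X → E) (c : E) (x : X) :
    lowerLip (fun y => dist (f y) c) x ≤ lowerLip f x := by
  refine liminf_le_liminf (Eventually.of_forall fun s => iSup₂_mono fun y _ => ?_)
  gcongr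
  rw [edist_dist, edist_dist]
  exact ENNReal.ofReal_le_ofReal (abs_dist_sub_le _ _ _)

/-- The lower pointwise Lipschitz constant dominates the speed of a real function along a curve of
speed `ℓ`. -/
theorem enorm_deriv_le_lowerLip {g : X → ℝ} {c : ℝ → X} {ℓ t d : ℝ} (hℓ : 0 < ℓ)
    (hc : ∀ᶠ u in 𝓝[>] t, dist (c u) (c t) = (u - t) * ℓ)
    (hd : HasDerivAt (fun u => g (c u)) d t) :
    ‖d‖ₑ ≤ ENNReal.ofReal ℓ * lowerLip g (c t) := by
  have hab : ∀ a : ℝ, 0 < a → a < 1 →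
      ENNReal.ofReal a * ENNReal.ofReal (|d| / ℓ) ≤ lowerLip g (c t) := by
    intro a ha ha1
    have hu : Tendsto (fun s : ℝ => t + a * s / ℓ) (𝓝[>] 0) (𝓝[>] t) := by
      refine tendsto_nhdsWithin_iff.2 ⟨?_, ?_⟩
      · have : Continuous fun s : ℝ => t + a * s / ℓ := by fun_prop
        simpa using (this.tendsto 0).mono_left nhdsWithin_le_nhds
      · filter_upwards [self_mem_nhdsWithin] with s hs
        have hs : (0 : ℝ) < s := hs
        have : 0 < a * s / ℓ := by positivity
        simpa using this
    have hslope : Tendsto (fun s : ℝ => ENNReal.ofReal a *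
        ENNReal.ofReal (|slope (fun u => g (c u)) t (t + a * s / ℓ)| / ℓ)) (𝓝[>] 0)
        (𝓝 (ENNReal.ofReal a * ENNReal.ofReal (|d| / ℓ))) := by
      have h1 := (hasDerivAt_iff_tendsto_slope.1 hd).mono_left
        (nhdsWithin_mono t fun u (hu : t < u) => hu.ne')
      exact ENNReal.Tendsto.const_mul (ENNReal.tendsto_ofReal
        (((continuous_abs.tendsto d).comp (h1.comp hu)).div_const ℓ)) (Or.inr ENNReal.ofReal_ne_top)
    rw [← hslope.liminf_eq]
    refine liminf_le_liminf ?_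
    filter_upwards [self_mem_nhdsWithin, hu.eventually hc] with s hs hdist
    have hs : (0 : ℝ) < s := hs
    have e1 : t + a * s / ℓ - t = a * s / ℓ := by ring
    rw [e1, div_mul_cancel₀ _ hℓ.ne'] at hdist
    refine le_iSup₂_of_le (c (t + a * s / ℓ)) ?_ ?_
    · rw [Metric.mem_ball, hdist]; nlinarith
    rw [slope_def_field, e1, edist_dist, Real.dist_eq, ← ENNReal.ofReal_div_of_pos hs,
      ← ENNReal.ofReal_mul ha.le, abs_div, abs_of_pos (show 0 < a * s / ℓ by positivity)]
    apply ENNReal.ofReal_le_ofReal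
    apply le_of_eq
    field_simp
  have hlim : Tendsto (fun a : ℝ => ENNReal.ofReal a * ENNReal.ofReal (|d| / ℓ)) (𝓝[<] 1)
      (𝓝 (ENNReal.ofReal 1 * ENNReal.ofReal (|d| / ℓ))) :=
    ENNReal.Tendsto.mul_const
      (ENNReal.tendsto_ofReal (tendsto_id.mono_left nhdsWithin_le_nhds)) (Or.inl (by simp))
  have hle : ENNReal.ofReal (|d| / ℓ) ≤ lowerLip g (c t) := by
    rw [ENNReal.ofReal_one, one_mul] at hlim
    refine le_of_tendsto hlim ?_
    filter_upwards [Ioo_mem_nhdsLT (show (0 : ℝ) < 1 by norm_num)] with a ha using hab a ha.1 ha.2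
  calc ‖d‖ₑ = ENNReal.ofReal ℓ * ENNReal.ofReal (|d| / ℓ) := by
        rw [← ENNReal.ofReal_mul hℓ.le, mul_div_cancel₀ _ hℓ.ne', Real.enorm_eq_ofReal_abs]
    _ ≤ _ := by gcongr

/-- The lower pointwise Lipschitz constant is an upper gradient along minimal geodesics. -/
theorem edist_le_lintegral_lowerLip {f : X → E} {L : ℝ≥0} (hf : LipschitzWith L f) (γ : Geo X) :
    edist (f (Geo.ev 1 γ)) (f (Geo.ev 0 γ)) ≤ ENNReal.ofReal γ.length *
      ∫⁻ t in Ioc (0 : ℝ) 1, lowerLip f (Geo.ev (projIcc 0 1 zero_le_one t) γ) := by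
  rcases γ.length_nonneg.eq_or_lt with h0 | h0
  · have : Geo.ev 0 γ = Geo.ev 1 γ := dist_eq_zero.1 h0.symm
    simp [this]
  let g : X → ℝ := fun y => dist (f y) (f (Geo.ev 0 γ))
  let c : ℝ → X := fun t => Geo.ev (projIcc 0 1 zero_le_one t) γ
  have hcI : ∀ s ∈ Icc (0 : ℝ) 1, ∀ t ∈ Icc (0 : ℝ) 1, dist (c s) (c t) = |s - t| * γ.length := by
    intro s hs t ht
    simp only [c, Geo.dist_ev_ev, projIcc_of_mem _ hs, projIcc_of_mem _ ht]
  have hg : ∀ y z, |g y - g z| ≤ L * dist y z := fun y z =>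
    (abs_dist_sub_le _ _ _).trans (hf.dist_le_mul y z)
  have hlip : LipschitzOnWith (L * γ.length.toNNReal) (fun t => g (c t)) (uIcc 0 1) := by
    refine LipschitzOnWith.of_dist_le_mul fun s hs t ht => ?_
    rw [uIcc_of_le zero_le_one] at hs ht
    rw [Real.dist_eq, Real.dist_eq]
    refine (hg _ _).trans (le_of_eq ?_)
    rw [hcI s hs t ht, NNReal.coe_mul, Real.coe_toNNReal _ h0.le]; ring
  have hac := hlip.absolutelyContinuousOnInterval
  have hint := hac.integral_deriv_eq_sub
  have c1 : c 1 = Geo.ev 1 γ := by simp [c, projIcc_right]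
  have c0 : c 0 = Geo.ev 0 γ := by simp [c, projIcc_left]
  have hgc : g (c 1) - g (c 0) = dist (f (Geo.ev 1 γ)) (f (Geo.ev 0 γ)) := by
    simp [g, c0, c1]
  rw [edist_dist, ← hgc, ← hint, intervalIntegral.integral_of_le zero_le_one]
  calc ENNReal.ofReal (∫ t in Ioc (0 : ℝ) 1, deriv (fun t => g (c t)) t)
      ≤ ‖∫ t in Ioc (0 : ℝ) 1, deriv (fun t => g (c t)) t‖ₑ := by
        rw [Real.enorm_eq_ofReal_abs]; exact ENNReal.ofReal_le_ofReal (le_abs_self _)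
    _ ≤ ∫⁻ t in Ioc (0 : ℝ) 1, ‖deriv (fun t => g (c t)) t‖ₑ := enorm_integral_le_lintegral_enorm _
    _ ≤ ∫⁻ t in Ioc (0 : ℝ) 1, ENNReal.ofReal γ.length * lowerLip f (c t) := by
        refine lintegral_mono_ae ?_
        have hne : ∀ᵐ t : ℝ, t ≠ 1 := by simp [ae_iff, measure_singleton]
        filter_upwards [ae_restrict_mem measurableSet_Ioc, ae_restrict_of_ae hac.ae_differentiableAt,
          ae_restrict_of_ae hne] with t ht hdiff ht1
        have htI : t ∈ Icc (0 : ℝ) 1 := Ioc_subset_Icc_self ht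
        have hd := (hdiff (by rwa [uIcc_of_le zero_le_one])).hasDerivAt
        refine (enorm_deriv_le_lowerLip h0 ?_ hd).trans
          (mul_le_mul_right (lowerLip_dist_le f _ _) _)
        filter_upwards [Ioo_mem_nhdsGT (lt_of_le_of_ne ht.2 ht1)] with u hu
        rw [hcI u ⟨ht.1.le.trans hu.1.le, hu.2.le⟩ t htI, abs_of_pos (sub_pos.2 hu.1)]
    _ = _ := lintegral_const_mul' _ _ ENNReal.ofReal_ne_top

end LowerLip

/-! ### The Poincaré inequality below the critical radius -/

theorem lintegral_le_lintegral_rpow {α : Type*} [MeasurableSpace α] {P : Measure α}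
    [IsProbabilityMeasure P] {p : ℝ} (hp : 1 ≤ p) {g : α → ℝ≥0∞} (hg : Measurable g) :
    ∫⁻ a, g a ∂P ≤ (∫⁻ a, g a ^ p ∂P) ^ (1 / p) := by
  have := eLpNorm'_le_eLpNorm'_of_exponent_le one_pos hp P hg.aestronglyMeasurable
  simpa [eLpNorm'] using this

theorem lintegral_Ioc_rpow {c s : ℝ} (hc : 0 ≤ c) (hs : -1 < s) :
    ∫⁻ t in Ioc (0 : ℝ) 1, ENNReal.ofReal (c * t ^ s) = ENNReal.ofReal (c / (s + 1)) := by
  have hint : IntervalIntegrable (fun t : ℝ => c * t ^ s) volume 0 1 :=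
    (intervalIntegral.intervalIntegrable_rpow' hs).const_mul c
  rw [← ofReal_integral_eq_lintegral_ofReal
    ((intervalIntegrable_iff_integrableOn_Ioc_of_le zero_le_one).1 hint),
    ← intervalIntegral.integral_of_le zero_le_one, intervalIntegral.integral_const_mul,
    integral_rpow (Or.inl hs)]
  · rw [Real.one_rpow, Real.zero_rpow (by linarith), sub_zero, mul_one_div]
  · filter_upwards [ae_restrict_mem measurableSet_Ioc] with t ht
    exact mul_nonneg hc (Real.rpow_nonneg ht.1.le _)

/-- The average is, up to a factor two, the best constant in the `L¹` mean. -/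
theorem laverage_sub_average_le {X E : Type*} [MeasurableSpace X] [NormedAddCommGroup E]
    [NormedSpace ℝ E] [CompleteSpace E] {ν : Measure X} [IsFiniteMeasure ν] [NeZero ν] {f : X → E}
    (hf : Integrable f ν) (a : E) :
    ⨍⁻ y, ‖f y - ⨍ z, f z ∂ν‖ₑ ∂ν ≤ 2 * ⨍⁻ y, ‖f y - a‖ₑ ∂ν := by
  have hav : ‖a - ⨍ z, f z ∂ν‖ₑ ≤ ⨍⁻ y, ‖f y - a‖ₑ ∂ν := by
    have hP : IsProbabilityMeasure ((ν univ)⁻¹ • ν) := inferInstance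
    have hf' : Integrable f ((ν univ)⁻¹ • ν) := hf.to_average
    have : a - ⨍ z, f z ∂ν = -∫ z, (f z - a) ∂((ν univ)⁻¹ • ν) := by
      rw [integral_sub hf' (integrable_const a), average_eq', integral_const]
      simp
    rw [this, enorm_neg, laverage_eq']
    exact enorm_integral_le_lintegral_enorm _
  calc ⨍⁻ y, ‖f y - ⨍ z, f z ∂ν‖ₑ ∂ν
      ≤ ∫⁻ y, (‖f y - a‖ₑ + ‖a - ⨍ z, f z ∂ν‖ₑ) ∂((ν univ)⁻¹ • ν) := by
        rw [laverage_eq']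
        refine lintegral_mono fun y => ?_
        rw [← sub_add_sub_cancel (f y) a]
        exact enorm_add_le _ _
    _ = ⨍⁻ y, ‖f y - a‖ₑ ∂ν + ‖a - ⨍ z, f z ∂ν‖ₑ := by
        rw [lintegral_add_right _ measurable_const, lintegral_const,
          measure_univ (μ := (ν univ)⁻¹ • ν), mul_one, laverage_eq']
    _ ≤ _ := by rw [two_mul]; gcongr

section Poincare

variable {X : Type*} [MetricSpace X] [ProperSpace X] [MeasurableSpace X] [BorelSpace X]
  {K n : ℝ} {μ : Measure X}

/-- A Morrey type estimate: the mean distance of `f` on a ball to its value at the centre is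
controlled by the `L^p` mean of the lower pointwise Lipschitz constant, because `t ^ (-n/p)` is
integrable at zero. Geodesics starting at the centre do not leave the ball, so that no larger ball
is needed. -/
theorem IsMCP.laverage_edist_center_le (hX : IsMCP K n μ) {E : Type*} [MetricSpace E]
    {f : X → E} {L : ℝ≥0}
    (hf : LipschitzWith L f) {p c r : ℝ} (hp : n < p) (hc : 0 < c) (hr : 0 < r)
    (hrK : 0 < K → r ≤ bonnetMyersRadius K n)
    (hcoeff : ∀ t ℓ : ℝ, 0 ≤ t → t ≤ 1 → 0 ≤ ℓ → ℓ < r → c * t ^ n ≤ mcpCoeff K n t ℓ) (x : X) :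
    ⨍⁻ y in Metric.ball x r, edist (f y) (f x) ∂μ ≤
      ENNReal.ofReal (c ^ (-(1 / p)) / (1 - n / p) * r) *
        (⨍⁻ y in Metric.ball x r, lowerLip f y ^ p ∂μ) ^ (1 / p) := by
  have hn := hX.one_le
  have hp0 : 0 < p := by linarith
  set A := Metric.ball x r with hA
  have hAm : MeasurableSet A := measurableSet_ball
  have hA0 : 0 < μ A := hX.ball_pos x r hr
  have hAtop : μ A < ∞ := hX.ball_lt_top x r
  obtain ⟨P, hP, hae, h1, hcon⟩ := hX.exists_contraction x hAm hA0 hAtop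
    fun hK => Metric.ball_subset_ball (hrK hK)
  have hlm : Measurable (lowerLip f) := measurable_lowerLip hf.continuous
  set Q : ℝ≥0∞ := ⨍⁻ y in A, lowerLip f y ^ p ∂μ with hQ
  let τ : ℝ → unitInterval := projIcc 0 1 zero_le_one
  have hslice : ∀ t ∈ Ioc (0 : ℝ) 1, ∫⁻ γ, lowerLip f (Geo.ev (τ t) γ) ∂P ≤
      ENNReal.ofReal (c ^ (-(1 / p)) * t ^ (-(n / p))) * Q ^ (1 / p) := by
    intro t ht
    have hτ : ((τ t : unitInterval) : ℝ) = t := by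
      simp [τ, projIcc_of_mem _ (Ioc_subset_Icc_self ht)]
    have hct : 0 < c * t ^ n := mul_pos hc (Real.rpow_pos_of_pos ht.1 n)
    have h2 := hcon (τ t) (c * t ^ n) A (fun y => lowerLip f y ^ p) hAm (hlm.pow_const p) (by
      intro γ h0 h1
      have hlen : γ.length < r := by
        rw [hA, Metric.mem_ball, ← h0, dist_comm] at h1; exact h1
      refine ⟨?_, ?_⟩
      · rw [hA, Metric.mem_ball, ← h0, dist_comm, Geo.dist_ev_zero_ev, hτ]
        nlinarith [γ.length_nonneg, ht.2]
      · rw [hτ]; exact hcoeff t _ ht.1.le ht.2 γ.length_nonneg hlen)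
    have h3 : ∫⁻ γ, lowerLip f (Geo.ev (τ t) γ) ^ p ∂P ≤ (ENNReal.ofReal (c * t ^ n))⁻¹ * Q := by
      rw [hQ, setLAverage_eq, ENNReal.div_eq_inv_mul, ← mul_assoc,
        ← ENNReal.mul_inv (Or.inr hAtop.ne) (Or.inr hA0.ne'), ← ENNReal.div_eq_inv_mul,
        ENNReal.le_div_iff_mul_le
          (Or.inl (mul_ne_zero (ENNReal.ofReal_pos.2 hct).ne' hA0.ne'))
          (Or.inl (ENNReal.mul_ne_top ENNReal.ofReal_ne_top hAtop.ne)), mul_comm]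
      exact h2
    refine (lintegral_le_lintegral_rpow (p := p) (by linarith)
      (hlm.comp (Geo.measurable_ev _))).trans ?_
    refine (ENNReal.rpow_le_rpow h3 (by positivity)).trans (le_of_eq ?_)
    rw [ENNReal.mul_rpow_of_nonneg _ _ (by positivity), ← ENNReal.ofReal_inv_of_pos hct,
      ENNReal.ofReal_rpow_of_pos (by positivity)]
    congr 2
    rw [← Real.rpow_neg_one, ← Real.rpow_mul hct.le,
      Real.mul_rpow hc.le (Real.rpow_nonneg ht.1.le _), ← Real.rpow_mul ht.1.le]
    congr 2 <;> ring
  have hjoint : Measurable (Function.uncurry fun (γ : Geo X) (t : ℝ) =>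
      lowerLip f (Geo.ev (τ t) γ)) := by
    refine hlm.comp (Continuous.measurable ?_)
    have h : Continuous fun q : Geo X × ℝ => (q.1.1, τ q.2) :=
      (continuous_subtype_val.comp continuous_fst).prodMk
        (continuous_projIcc.comp continuous_snd)
    exact continuous_eval.comp h
  have hnp : n / p < 1 := (div_lt_one hp0).2 hp
  calc ⨍⁻ y in A, edist (f y) (f x) ∂μ
      = ∫⁻ γ, edist (f (Geo.ev 1 γ)) (f x) ∂P := by
        rw [setLAverage_eq', ← h1, lintegral_map
          (hf.continuous.edist continuous_const).measurable (Geo.measurable_ev 1)]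
    _ ≤ ∫⁻ γ, ENNReal.ofReal r * (∫⁻ t in Ioc (0 : ℝ) 1, lowerLip f (Geo.ev (τ t) γ)) ∂P := by
        refine lintegral_mono_ae ?_
        filter_upwards [hae] with γ hγ
        rw [← hγ.1]
        refine (edist_le_lintegral_lowerLip hf γ).trans (mul_le_mul_left ?_ _)
        apply ENNReal.ofReal_le_ofReal
        have := hγ.2
        rw [hA, Metric.mem_ball, ← hγ.1, dist_comm] at this
        exact this.le
    _ = ENNReal.ofReal r * ∫⁻ t in Ioc (0 : ℝ) 1, ∫⁻ γ, lowerLip f (Geo.ev (τ t) γ) ∂P := by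
        rw [lintegral_const_mul' _ _ ENNReal.ofReal_ne_top,
          lintegral_lintegral_swap hjoint.aemeasurable]
    _ ≤ ENNReal.ofReal r * ∫⁻ t in Ioc (0 : ℝ) 1,
          ENNReal.ofReal (c ^ (-(1 / p)) * t ^ (-(n / p))) * Q ^ (1 / p) := by
        exact mul_le_mul_right (setLIntegral_mono' measurableSet_Ioc hslice) _
    _ = _ := by
        rw [lintegral_mul_const _ (by fun_prop), lintegral_Ioc_rpow (by positivity) (by linarith),
          ← mul_assoc, ← ENNReal.ofReal_mul hr.le]
        congr 2
        ring

theorem IsMCP.poincareAtScale (hX : IsMCP K n μ) {p c r : ℝ} (hp : n < p) (hc : 0 < c) (hr : 0 < r)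
    (hrK : 0 < K → r ≤ bonnetMyersRadius K n)
    (hcoeff : ∀ t ℓ : ℝ, 0 ≤ t → t ≤ 1 → 0 ≤ ℓ → ℓ < r → c * t ^ n ≤ mcpCoeff K n t ℓ) :
    PoincareAtScale μ p 1 (2 * (c ^ (-(1 / p)) / (1 - n / p))) r := by
  rintro m f ⟨L, hf⟩ x
  have h := hX.laverage_edist_center_le hf hp hc hr hrK hcoeff x
  have hfin : IsFiniteMeasure (μ.restrict (Metric.ball x r)) :=
    ⟨by rw [Measure.restrict_apply_univ]; exact hX.ball_lt_top x r⟩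
  have hne : NeZero (μ.restrict (Metric.ball x r)) :=
    ⟨by rw [Ne, Measure.restrict_eq_zero]; exact (hX.ball_pos x r hr).ne'⟩
  have hint : Integrable f (μ.restrict (Metric.ball x r)) := by
    refine Measure.integrableOn_of_bounded (M := ‖f x‖ + L * r) (hX.ball_lt_top x r).ne
      hf.continuous.aestronglyMeasurable ?_
    filter_upwards [ae_restrict_mem measurableSet_ball] with y hy
    have h1 := norm_le_norm_add_norm_sub (f x) (f y)
    have h2 := hf.dist_le_mul x y
    rw [dist_eq_norm] at h2
    have h3 : dist x y ≤ r := by rw [dist_comm]; exact (Metric.mem_ball.1 hy).le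
    have := mul_le_mul_of_nonneg_left h3 L.2
    exact h1.trans (by simpa using h2.trans this)
  refine (laverage_sub_average_le hint (f x)).trans ?_
  simp only [edist_eq_enorm_sub] at h
  refine (mul_le_mul_right h 2).trans (le_of_eq ?_)
  rw [one_mul, ← mul_assoc, mul_assoc (2 : ℝ), ENNReal.ofReal_mul (by norm_num : (0 : ℝ) ≤ 2)]
  simp

end Poincare

/-! ### The Bonnet–Myers theorem and large balls -/

section BonnetMyers

variable {X : Type*} [MetricSpace X] [MeasurableSpace X] [BorelSpace X]
  {K n : ℝ} {μ : Measure X}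

/-- The part of the `ε`-neighbourhood of the minimal geodesics from `x` to `y`, measured by the
excess in the triangle inequality, that lies at distance between `a` and `b` from `x`. -/
def thinShell (x y : X) (ε a b : ℝ) : Set X :=
  {w | dist x w + dist w y < dist x y + ε ∧ a ≤ dist x w ∧ dist x w ≤ b}

theorem measurableSet_thinShell (x y : X) (ε a b : ℝ) : MeasurableSet (thinShell x y ε a b) :=
  (isOpen_lt ((continuous_const.dist continuous_id).add (continuous_id.dist continuous_const))
    continuous_const).measurableSet.inter
    ((isClosed_le continuous_const (continuous_const.dist continuous_id)).measurableSet.inter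
      (isClosed_le (continuous_const.dist continuous_id) continuous_const).measurableSet)

theorem IsMCP.measure_thinShell_lt_top (hX : IsMCP K n μ) (x y : X) (ε a b : ℝ) :
    μ (thinShell x y ε a b) < ∞ := by
  refine (measure_mono fun w hw => ?_).trans_lt (hX.ball_lt_top x (b + 1))
  rw [Metric.mem_ball, dist_comm]
  linarith [hw.2.2]

variable [ProperSpace X]

/-- The **Bonnet–Myers theorem** for the measure contraction property. If `dist x y` is slightly
larger than the critical distance `R`, a thin shell around `x` of radius about `R`, close to the
geodesics from `x` to `y`, can be contracted halfway to `x` and from there back into itself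
towards `y`. The first step multiplies the measure by an arbitrarily large factor and the second one
by a factor bounded below. -/
theorem IsMCP.dist_le_bonnetMyersRadius (hX : IsMCP K n μ) (hK : 0 < K) (hn : 1 < n) (x z : X) :
    dist x z ≤ bonnetMyersRadius K n := by
  by_contra! hz
  have hR := bonnetMyersRadius_pos hK hn
  set R := bonnetMyersRadius K n
  obtain ⟨δ, hδ0, hδR, hδz⟩ : ∃ δ, 0 < δ ∧ δ ≤ R / 8 ∧ R + δ ≤ dist x z :=
    ⟨min (R / 8) (dist x z - R), lt_min (by linarith) (by linarith), min_le_left _ _,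
      by linarith [min_le_right (R / 8) (dist x z - R)]⟩
  obtain ⟨y, hy, -⟩ := hX.exists_between x z (by linarith) hδz
  have hc0 : 0 < (δ / R) ^ n := Real.rpow_pos_of_pos (by positivity) n
  obtain ⟨ε, hε0, hεR, hε⟩ : ∃ ε, 0 < ε ∧ ε ≤ R / 80 ∧
      1 < (δ / R) ^ n * (1 / 2 * (R / (Real.pi * (3 * ε))) ^ (n - 1)) := by
    obtain ⟨M, hM⟩ := eventually_atTop.1 ((tendsto_rpow_atTop (sub_pos.2 hn)).eventually_gt_atTop
      (2 / (δ / R) ^ n))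
    have hpi := Real.pi_pos
    have hM0 : 0 < max M 1 := lt_max_of_lt_right one_pos
    refine ⟨min (R / 80) (R / (Real.pi * (3 * max M 1))), lt_min (by positivity) (by positivity),
      min_le_left _ _, ?_⟩
    set ε := min (R / 80) (R / (Real.pi * (3 * max M 1)))
    have hε0 : 0 < ε := lt_min (by positivity) (by positivity)
    have hle : ε ≤ R / (Real.pi * (3 * max M 1)) := min_le_right _ _
    have hu : M ≤ R / (Real.pi * (3 * ε)) := by
      refine (le_max_left M 1).trans ?_
      rw [le_div_iff₀ (by positivity)] at hle ⊢
      linarith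
    have := hM _ hu
    rw [div_lt_iff₀ hc0] at this
    linarith
  set T₀ := thinShell x y ε (R - 3 * ε) (R - ε)
  set T₁ := thinShell x y ε ((R - 3 * ε) / 2) ((R - ε) / 2)
  have hT₀pos : 0 < μ T₀ := by
    obtain ⟨w, hw, hwy⟩ := hX.exists_between x y (a := R - 2 * ε) (by linarith) (by linarith)
    refine (hX.ball_pos w (ε / 2) (by linarith)).trans_le (measure_mono fun v hv => ?_)
    rw [Metric.mem_ball] at hv
    have h1 := dist_triangle x w v
    have h2 := dist_triangle x v w
    have h3 := dist_triangle v w y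
    rw [dist_comm w v] at h1
    exact ⟨by linarith, by linarith, by linarith⟩
  have step₁ : ENNReal.ofReal (1 / 2 * (R / (Real.pi * (3 * ε))) ^ (n - 1)) * μ T₀ ≤ μ T₁ := by
    refine hX.mul_measure_le x (measurableSet_thinShell ..) (hX.measure_thinShell_lt_top ..)
      (fun _ w hw => ?_) (measurableSet_thinShell ..) ⟨1 / 2, by norm_num, by norm_num⟩ _ ?_
    · rw [Metric.mem_ball, dist_comm]; linarith [hw.2.2]
    intro γ h0 h1
    have hlen : γ.length = dist x (Geo.ev 1 γ) := by rw [← h0]; rfl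
    have d0 := γ.dist_ev_zero_ev ⟨1 / 2, by norm_num, by norm_num⟩
    have d1 := γ.dist_ev_ev_one ⟨1 / 2, by norm_num, by norm_num⟩
    obtain ⟨g1, g2, g3⟩ := h1
    rw [h0] at d0
    rw [← hlen] at g1 g2 g3
    have h3 := dist_triangle (Geo.ev ⟨1 / 2, by norm_num, by norm_num⟩ γ) (Geo.ev 1 γ) y
    refine ⟨⟨?_, ?_, ?_⟩, ?_⟩
    · simp only at d0 d1; linarith
    · simp only at d0; linarith
    · simp only at d0; linarith
    · exact le_mcpCoeff_half hK hn (by linarith) (by linarith) (by linarith) g2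
  -- The time for which the shell of radius about `R / 2` is sent onto radius about `R - 2 * ε`.
  obtain ⟨t, ht0, ht1, ht⟩ : ∃ t : ℝ, δ / R ≤ t ∧ t ≤ 2 / 5 ∧ t * (R / 2 + δ) = δ + 2 * ε := by
    refine ⟨(δ + 2 * ε) / (R / 2 + δ), ?_, ?_, div_mul_cancel₀ _ (by positivity)⟩
    · exact div_le_div₀ (by linarith) (by linarith) (by linarith) (by linarith)
    · rw [div_le_iff₀ (by linarith)]; linarith
  have hδR0 : 0 < δ / R := by positivity
  have step₂ : ENNReal.ofReal ((δ / R) ^ n) * μ T₁ ≤ μ T₀ := by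
    have hlen_lt : ∀ w ∈ T₁, dist y w < R + δ + ε - (R - 3 * ε) / 2 := fun w hw => by
      rw [dist_comm]; linarith [hw.1, hw.2.1]
    refine hX.mul_measure_le y (measurableSet_thinShell ..) (hX.measure_thinShell_lt_top ..)
      (fun _ w hw => ?_) (measurableSet_thinShell ..) ⟨t, by linarith, by linarith⟩ _ ?_
    · rw [Metric.mem_ball, dist_comm]; linarith [hlen_lt w hw]
    intro γ h0 h1
    have hlen : γ.length = dist y (Geo.ev 1 γ) := by rw [← h0]; rfl
    have hlt := hlen_lt _ h1
    have d0 := γ.dist_ev_zero_ev ⟨t, by linarith, by linarith⟩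
    have d1 := γ.dist_ev_ev_one ⟨t, by linarith, by linarith⟩
    obtain ⟨g1, g2, g3⟩ := h1
    rw [h0, dist_comm] at d0
    rw [dist_comm _ y, ← hlen] at g1
    rw [dist_comm] at d1
    rw [← hlen] at hlt
    simp only at d0 d1
    set v := Geo.ev ⟨t, by linarith, by linarith⟩ γ
    have h3 := dist_triangle x (Geo.ev 1 γ) v
    have h4 := dist_triangle x v y
    have htε : t * ε ≤ 2 / 5 * ε := mul_le_mul_of_nonneg_right ht1 hε0.le
    have htε0 : 0 ≤ t * ε := mul_nonneg (by linarith) hε0.le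
    have hup : t * γ.length ≤ t * (R / 2 + δ) + 5 / 2 * (t * ε) := by
      have := mul_le_mul_of_nonneg_left hlt.le (by linarith : 0 ≤ t)
      linarith
    have hlow : t * (R / 2 + δ) + 1 / 2 * (t * ε) ≤ t * γ.length := by
      have h5 := dist_triangle x (Geo.ev 1 γ) y
      rw [dist_comm (Geo.ev 1 γ) y, ← hlen] at h5
      have := mul_le_mul_of_nonneg_left (by linarith : R / 2 + δ + ε / 2 ≤ γ.length)
        (by linarith : 0 ≤ t)
      linarith
    refine ⟨⟨?_, ?_, ?_⟩, ?_⟩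
    · linarith
    · linarith
    · linarith
    · exact (Real.rpow_le_rpow hδR0.le ht0 (by linarith)).trans
        (rpow_le_mcpCoeff_of_pos hK hn (by linarith) (by linarith) γ.length_nonneg (by linarith))
  have hloop : ENNReal.ofReal ((δ / R) ^ n * (1 / 2 * (R / (Real.pi * (3 * ε))) ^ (n - 1))) * μ T₀ ≤
      1 * μ T₀ := by
    rw [ENNReal.ofReal_mul hc0.le, mul_assoc, one_mul]
    exact (mul_le_mul_right step₁ _).trans step₂
  rw [ENNReal.mul_le_mul_iff_left hT₀pos.ne' (hX.measure_thinShell_lt_top ..).ne] at hloop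
  exact absurd (ENNReal.ofReal_le_one.1 hloop) (not_le.2 hε)

theorem IsMCP.isUnifLocDoublingMeasure (hX : IsMCP K n μ) (hK : 0 < K) (hn : 1 < n) :
    IsUnifLocDoublingMeasure μ := by
  refine ⟨⟨2 ^ n, ?_⟩⟩
  have hR := bonnetMyersRadius_pos hK hn
  filter_upwards [Ioo_mem_nhdsGT (half_pos hR)] with ε hε x
  have h2ε : 2 * ε < bonnetMyersRadius K n := by linarith [hε.2]
  have hfin : μ (Metric.closedBall x (2 * ε)) < ∞ :=
    (measure_mono (Metric.closedBall_subset_ball h2ε)).trans_lt (hX.ball_lt_top x _)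
  have h := hX.mul_measure_le x (A := Metric.closedBall x (2 * ε)) (T := Metric.closedBall x ε)
    Metric.isClosed_closedBall.measurableSet hfin
    (fun _ => Metric.closedBall_subset_ball h2ε) Metric.isClosed_closedBall.measurableSet
    ⟨1 / 2, by norm_num, by norm_num⟩ ((1 / 2) ^ n) (by
      intro γ h0 h1
      have hlen : γ.length ≤ 2 * ε := by
        rw [Metric.mem_closedBall, ← h0, dist_comm] at h1; exact h1
      refine ⟨?_, rpow_le_mcpCoeff_of_pos hK hn (by norm_num) (by norm_num) γ.length_nonneg
        (by linarith)⟩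
      rw [Metric.mem_closedBall, ← h0, dist_comm, Geo.dist_ev_zero_ev]
      simp only; linarith)
  have e : ((2 ^ n : ℝ≥0) : ℝ≥0∞) = ENNReal.ofReal (2 ^ n) := by
    rw [← ENNReal.ofReal_coe_nnreal, NNReal.coe_rpow]; rfl
  calc μ (Metric.closedBall x (2 * ε))
      = ENNReal.ofReal (2 ^ n) * (ENNReal.ofReal ((1 / 2) ^ n) * μ (Metric.closedBall x (2 * ε))) := by
        rw [← mul_assoc, ← ENNReal.ofReal_mul (by positivity),
          ← Real.mul_rpow (by norm_num) (by norm_num)]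
        norm_num
    _ ≤ _ := by rw [e]; exact mul_le_mul_right h _

/-- Spheres of the critical radius are null: they are porous, since a geodesic from the centre
reaches each of their points, and porous sets have no density points. -/
theorem IsMCP.measure_sphere (hX : IsMCP K n μ) (hK : 0 < K) (hn : 1 < n) (x : X) :
    μ (Metric.sphere x (bonnetMyersRadius K n)) = 0 := by
  have hR := bonnetMyersRadius_pos hK hn
  set R := bonnetMyersRadius K n
  have := hX.isUnifLocDoublingMeasure hK hn
  have : IsLocallyFiniteMeasure μ :=
    ⟨fun y => ⟨Metric.ball y 1, Metric.ball_mem_nhds y one_pos, hX.ball_lt_top y 1⟩⟩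
  have hfalse : ∀ᵐ y ∂μ.restrict (Metric.sphere x R), False := by
    filter_upwards [IsUnifLocDoublingMeasure.ae_tendsto_measure_inter_div μ (Metric.sphere x R) 2,
      ae_restrict_mem Metric.isClosed_sphere.measurableSet] with y hy hyS
    have hyx : dist x y = R := by rw [dist_comm]; exact hyS
    have hpos : ∀ j : ℕ, 0 < R * (1 / ((j : ℝ) + 1)) := fun j => by positivity
    have hle : ∀ j : ℕ, R * (1 / ((j : ℝ) + 1)) ≤ R := fun j => by
      refine mul_le_of_le_one_right hR.le ?_
      rw [div_le_one (by positivity)]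
      linarith [j.cast_nonneg (α := ℝ)]
    have hex : ∀ j : ℕ, ∃ w, dist x w = R - R * (1 / ((j : ℝ) + 1)) ∧
        dist w y = R * (1 / ((j : ℝ) + 1)) := fun j => by
      obtain ⟨w, h1, h2⟩ := hX.exists_between x y (a := R - R * (1 / ((j : ℝ) + 1)))
        (by linarith [hle j]) (by linarith [hpos j])
      exact ⟨w, h1, by linarith⟩
    choose w hw1 hw2 using hex
    have hlim : Tendsto (fun j : ℕ => R * (1 / ((j : ℝ) + 1)) / 2) atTop (𝓝[>] 0) := by
      refine tendsto_nhdsWithin_iff.2 ⟨?_, Eventually.of_forall fun j => half_pos (hpos j)⟩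
      simpa using (tendsto_one_div_add_atTop_nhds_zero_nat.const_mul R).div_const 2
    have h1 := hy w _ hlim (Eventually.of_forall fun j => by
      rw [Metric.mem_closedBall, dist_comm, hw2]; linarith)
    have hempty : ∀ j : ℕ, Metric.sphere x R ∩
        Metric.closedBall (w j) (R * (1 / ((j : ℝ) + 1)) / 2) = ∅ := by
      intro j
      rw [eq_empty_iff_forall_notMem]
      rintro v ⟨hv1, hv2⟩
      rw [Metric.mem_sphere, dist_comm] at hv1
      rw [Metric.mem_closedBall, dist_comm] at hv2
      have := dist_triangle x (w j) v
      linarith [hpos j, hw1 j]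
    simp only [hempty, measure_empty, ENNReal.zero_div] at h1
    exact zero_ne_one (tendsto_nhds_unique tendsto_const_nhds h1)
  rw [eventually_false_iff_eq_bot, ae_eq_bot, Measure.restrict_eq_zero] at hfalse
  exact hfalse

theorem IsMCP.ball_ae_eq_ball (hX : IsMCP K n μ) (hK : 0 < K) (hn : 1 < n) (x : X) {r : ℝ}
    (hr : bonnetMyersRadius K n ≤ r) :
    Metric.ball x r =ᵐ[μ] Metric.ball x (bonnetMyersRadius K n) := by
  refine EventuallyLE.antisymm (ae_le_set.2 (measure_mono_null ?_ (hX.measure_sphere hK hn x)))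
    (Metric.ball_subset_ball hr).eventuallyLE
  rintro y ⟨-, hy⟩
  rw [Metric.mem_ball, not_lt] at hy
  exact le_antisymm (hX.dist_le_bonnetMyersRadius hK hn y x) hy

theorem IsMCP.globalPoincare (hX : IsMCP K n μ) {p : ℝ} (hp : n < p) (hK : 0 ≤ K) :
    GlobalPoincare μ p := by
  have hp0 : 0 < p := by linarith [hX.one_le]
  have hnp : 0 < 1 - n / p := sub_pos.2 ((div_lt_one hp0).2 hp)
  refine ⟨1, 2 * (1 ^ (-(1 / p)) / (1 - n / p)), one_pos, by positivity, ?_⟩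
  rcases hK.eq_or_lt with rfl | hK
  · intro r hr
    refine hX.poincareAtScale hp one_pos hr (fun h => absurd h (lt_irrefl _)) ?_
    intro t ℓ ht ht1 _ _
    rw [one_mul]
    exact rpow_le_mcpCoeff_zero hX.one_le ht ht1
  have hn : 1 < n := lt_of_le_of_ne hX.one_le fun h => not_lt.2 (hX.nonpos_of_eq_one h.symm) hK
  have hsmall : ∀ r, 0 < r → r ≤ bonnetMyersRadius K n →
      PoincareAtScale μ p 1 (2 * (1 ^ (-(1 / p)) / (1 - n / p))) r := by
    intro r hr hrR
    refine hX.poincareAtScale hp one_pos hr (fun _ => hrR) ?_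
    intro t ℓ ht ht1 hℓ hℓr
    rw [one_mul]
    exact rpow_le_mcpCoeff_of_pos hK hn ht ht1 hℓ (hℓr.trans_le hrR)
  intro r hr
  rcases le_total r (bonnetMyersRadius K n) with hrR | hrR
  · exact hsmall r hr hrR
  intro m f hf x
  have h := hsmall _ (bonnetMyersRadius_pos hK hn) le_rfl m f hf x
  rw [one_mul] at h ⊢
  rw [Measure.restrict_congr_set (hX.ball_ae_eq_ball hK hn x hrR)]
  refine h.trans (mul_le_mul_left (ENNReal.ofReal_le_ofReal ?_) _)
  exact mul_le_mul_of_nonneg_left hrR (by positivity)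

theorem IsMCP.localPoincare (hX : IsMCP K n μ) {p : ℝ} (hp : n < p) : LocalPoincare μ p := by
  rcases le_or_gt 0 K with hK | hK
  · obtain ⟨C, C', hC, hC', h⟩ := hX.globalPoincare hp hK
    exact ⟨1, one_pos, C, C', hC, hC', fun r hr _ => h r hr⟩
  obtain ⟨r₀, hr₀, c, hc, h⟩ := exists_le_mcpCoeff_of_neg hK hX.one_le
  have hp0 : 0 < p := by linarith [hX.one_le]
  have hnp : 0 < 1 - n / p := sub_pos.2 ((div_lt_one hp0).2 hp)
  refine ⟨r₀, hr₀, 1, 2 * (c ^ (-(1 / p)) / (1 - n / p)), one_pos, by positivity, ?_⟩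
  intro r hr hr0
  exact hX.poincareAtScale hp hc hr (fun h => absurd h (not_lt.2 hK.le))
    fun t ℓ ht ht1 hℓ hℓr => h t ℓ ht ht1 hℓ (hℓr.trans hr0)

end BonnetMyers

end MCPPoincare

theorem theorem1p3 {X : Type*} [MetricSpace X] [ProperSpace X] [MeasurableSpace X] [BorelSpace X]
    (μ : Measure X) (K n : ℝ) (hX : MCPPoincare.IsMCP K n μ) (p : ℝ) (hp : n + 1 < p) :
    MCPPoincare.LocalPoincare μ p ∧ (0 ≤ K → MCPPoincare.GlobalPoincare μ p) :=
  ⟨hX.localPoincare (by linarith), hX.globalPoincare (by linarith)⟩
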